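/- Let the legitimate nodes $\Phi_l$ and the eavesdroppers $\Phi_e$ be independent homogeneous Poisson point processes in $\mathbb{R}^2$ with densities $\lambda_l \ge 0$ and $\lambda_e \ge 0$. Time is slotted, and the legitimate nodes use slotted ALOHA with parameter $p \in [0,1]$: in every slot each node transmits with probability $p$, all these decisions being independent of each other and of the positions of all nodes and eavesdroppers. In a fixed slot let $\Phi_t \subseteq \Phi_l$ be the set of transmitting nodes and $\Phi_r = \Phi_l \setminus \Phi_t$ the set of receiving nodes (half-duplex operation). Let $\eta, \beta_l, \beta_e > 0$. A transmitter $x$ can securely connect to a receiver $y$ if (C1) $\|x-y\| < \eta$; (C2) the disk $\mathbb{B}(y, \beta_l\|x-y\|)$ contains no transmitter other than $x$; (C3) the disk $\mathbb{B}(x, \beta_e\|x-y\|)$ contains no eavesdropper. Consider the typical transmitter, i.e. an additional transmitter located at the origin, and let $N_{t,0}$ be its secure out-degree, i.e. the number of $y \in \Phi_r$ to which it can securely connect, the set of transmitters being $\Phi_t \cup \{0\}$. If $\lambda_l p \beta_l^2 + \lambda_e\beta_e^2 \neq 0$, then $$\mathbb{E} N_{t,0} = \frac{\lambda_l(1-p)\left[1-\exp\left(-(\lambda_l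 p \beta_l^2 + \lambda_e \beta_e^2)\pi\eta^2\right)\right]}{\lambda_l p \beta_l^2 + \lambda_e \beta_e^2}.$$ -/

import Mathlib

open MeasureTheory ProbabilityTheory
open scoped NNReal ENNReal

namespace SecureGraph

/-- The Euclidean plane. -/
abbrev Plane : Type := EuclideanSpace ℝ (Fin 2)

/-- Number of points of the random set `Φ` in `B`. -/
noncomputable def count {Ω : Type*} (Φ : Ω → Set Plane) (B : Set Plane) (ω : Ω) : ℕ∞ :=
  (Φ ω ∩ B).encard

/-- The σ-algebra on `Ω` generated by a random point set, that is, by its counts on Borel sets. -/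
@[reducible] noncomputable def sigmaPoints {Ω : Type*} (Φ : Ω → Set Plane) : MeasurableSpace Ω :=
  ⨆ B : {B : Set Plane // MeasurableSet B}, MeasurableSpace.comap (count Φ B.1) inferInstance

/-- `Φ` is a homogeneous Poisson point process of density `lam` in the plane: a random locally
finite set whose number of points in a Borel set `B` of finite area is Poisson distributed with
mean `lam * area B`, and whose numbers of points in pairwise disjoint Borel sets are independent. -/
structure IsPoissonProcess {Ω : Type*} [MeasurableSpace Ω] (μ : Measure Ω)
    (Φ : Ω → Set Plane) (lam : ℝ≥0) : Prop where
  locallyFinite : ∀ ω, ∀ B : Set Plane, Bornology.IsBounded B → (Φ ω ∩ B).Finite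
  measurable_count : ∀ B : Set Plane, MeasurableSet B → Measurable (count Φ B)
  law_count : ∀ B : Set Plane, MeasurableSet B → volume B ≠ ∞ →
    HasLaw (count Φ B)
      ((poissonMeasure (lam * (volume B).toNNReal)).map (Nat.cast : ℕ → ℕ∞)) μ
  indep_count : ∀ (m : ℕ) (B : Fin m → Set Plane), (∀ i, MeasurableSet (B i)) →
    Pairwise (fun i j => Disjoint (B i) (B j)) → iIndepFun (fun i => count Φ (B i)) μ

/-- The slotted ALOHA protocol with transmission probability `p` run by the nodes `Φl`, in the
presence of eavesdroppers `Φe`. The nodes are listed measurably and without repetition as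
`node i ω`, `i < num ω`; in slot `k` the `i`-th node transmits if and only if `tx k i ω = true`.
All the decisions `tx k i` are independent of each other and of the positions of all nodes and
eavesdroppers, and each of them is `true` with probability `p`. -/
structure SlottedAloha {Ω : Type*} [MeasurableSpace Ω] (μ : Measure Ω)
    (Φl Φe : Ω → Set Plane) (p : ℝ) where
  num : Ω → ℕ∞
  node : ℕ → Ω → Plane
  tx : ℕ → ℕ → Ω → Bool
  measurable_num : Measurable num
  measurable_node : ∀ i, Measurable (node i)
  measurable_tx : ∀ k i, Measurable (tx k i)
  node_injective : ∀ (ω : Ω) (i j : ℕ), (i : ℕ∞) < num ω → (j : ℕ∞) < num ω →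
    node i ω = node j ω → i = j
  nodes_eq : ∀ ω, Φl ω = {x | ∃ i : ℕ, (i : ℕ∞) < num ω ∧ node i ω = x}
  prob_tx : ∀ k i, μ {ω | tx k i ω = true} = ENNReal.ofReal p
  indep_tx : iIndepFun (fun q : ℕ × ℕ => tx q.1 q.2) μ
  indep_positions :
    Indep (⨆ q : ℕ × ℕ, MeasurableSpace.comap (tx q.1 q.2) inferInstance)
      (MeasurableSpace.comap num inferInstance ⊔
        (⨆ i : ℕ, MeasurableSpace.comap (node i) inferInstance) ⊔ sigmaPoints Φe) μ

/-- The set `Φ_t(k)` of nodes that transmit in slot `k`. -/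
def SlottedAloha.transmitters {Ω : Type*} [MeasurableSpace Ω] {μ : Measure Ω}
    {Φl Φe : Ω → Set Plane} {p : ℝ} (A : SlottedAloha μ Φl Φe p) (k : ℕ) (ω : Ω) : Set Plane :=
  {x | ∃ i : ℕ, (i : ℕ∞) < A.num ω ∧ A.tx k i ω = true ∧ A.node i ω = x}

/-- The set `Φ_r(k)` of receiving nodes in slot `k`: by half-duplex operation, these are the nodes
that do not transmit. -/
def SlottedAloha.receivers {Ω : Type*} [MeasurableSpace Ω] {μ : Measure Ω}
    {Φl Φe : Ω → Set Plane} {p : ℝ} (A : SlottedAloha μ Φl Φe p) (k : ℕ) (ω : Ω) : Set Plane :=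
  Φl ω \ A.transmitters k ω

/-- With transmitters `T` and eavesdroppers `D`, the transmitter `x` can securely connect to the
receiver `y`: the range, the interference and the secrecy constraint. The interference
constraint is on the transmitters other than `x` itself. -/
structure SecurelyConnects (T D : Set Plane) (η βl βe : ℝ) (x y : Plane) : Prop where
  range : ‖x - y‖ < η
  interference : ∀ z ∈ T, z ≠ x → z ∉ Metric.closedBall y (βl * ‖x - y‖)
  secrecy : ∀ z ∈ D, z ∉ Metric.closedBall x (βe * ‖x - y‖)

/-- Secure out-degree of the transmitter `x`: the number of receivers in `R` to which it can
securely connect. -/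
noncomputable def secureOutDegree (T R D : Set Plane) (η βl βe : ℝ) (x : Plane) : ℕ∞ :=
  {y | y ∈ R ∧ SecurelyConnects T D η βl βe x y}.encard

/-- Secure out-degree, in slot `k`, of a transmitter located at the origin, which is added to the
legitimate nodes of the network. -/
noncomputable def outDegreeAtOrigin {Ω : Type*} [MeasurableSpace Ω] {μ : Measure Ω}
    {Φl Φe : Ω → Set Plane} {p : ℝ} (A : SlottedAloha μ Φl Φe p) (η βl βe : ℝ) (k : ℕ)
    (ω : Ω) : ℕ∞ :=
  secureOutDegree (insert 0 (A.transmitters k ω)) (A.receivers k ω) (Φe ω) η βl βe 0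

end SecureGraph

/-!
Given all positions, the nodes in a finite set are silent with probability `1 - p` each,
independently. Combined with the Chen–Stein identity `𝔼[N f(N)] = r 𝔼[f(N + 1)]` for a Poisson
variable `N` of mean `r`, this shows that on the event that a bounded set `B` contains no
transmitter and that an event `F` about the eavesdroppers occurs, the mean number of receivers in
`C` is `λ_l (1 - p) |C|` times the probability of that event, wherever `C` lies relative to `B`.

Such events form a π-system, and secure connectivity from the origin is measurable with respect to
the σ-algebra they generate. Since a product measure is determined by its values on rectangles of
a generating π-system, the receivers satisfy the Campbell formula
`𝔼 N_{t,0} = λ_l (1 - p) ∫_{‖y‖ < η} ℙ(0 can securely connect to y) dy`.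
The integrand is the product of two Poisson void probabilities, and polar coordinates give the
integral.
-/

namespace SecureGraph

section Poisson

theorem add_one_mul_poissonMeasure_singleton (r : ℝ≥0) (n : ℕ) :
    ((n + 1 : ℕ) : ℝ≥0∞) * poissonMeasure r {n + 1} = r * poissonMeasure r {n} := by
  rw [poissonMeasure_singleton, poissonMeasure_singleton, ← ENNReal.ofReal_natCast,
    ← ENNReal.ofReal_coe_nnreal, ← ENNReal.ofReal_mul (by positivity),
    ← ENNReal.ofReal_mul (by positivity), Nat.factorial_succ]
  congr 1
  push_cast
  field_simp
  ring

theorem lintegral_natCast_mul_poissonMeasure (r : ℝ≥0) (f : ℕ → ℝ≥0∞) :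
    ∫⁻ n, (n : ℝ≥0∞) * f n ∂poissonMeasure r = r * ∫⁻ n, f (n + 1) ∂poissonMeasure r := by
  rw [lintegral_countable', lintegral_countable', tsum_eq_zero_add' ENNReal.summable,
    ← ENNReal.tsum_mul_left, Nat.cast_zero, zero_mul, zero_mul, zero_add]
  refine tsum_congr fun n => ?_
  rw [mul_right_comm, add_one_mul_poissonMeasure_singleton]
  ring

theorem lintegral_pow_poissonMeasure (r : ℝ≥0) {q : ℝ} (hq : 0 ≤ q) :
    ∫⁻ n, ENNReal.ofReal q ^ n ∂poissonMeasure r =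
      ENNReal.ofReal (Real.exp (-(r * (1 - q)))) := by
  have hsum : HasSum (fun n : ℕ => q ^ n * (Real.exp (-r) * r ^ n / n.factorial))
      (Real.exp (-(r * (1 - q)))) := by
    have h := (NormedSpace.expSeries_div_hasSum_exp (r * q)).mul_left (Real.exp (-r))
    rw [← Real.exp_eq_exp_ℝ, ← Real.exp_add] at h
    rw [show -(r * (1 - q)) = -r + r * q by ring]
    refine h.congr_fun fun n => ?_
    rw [mul_pow]
    ring
  rw [lintegral_countable', ← hsum.tsum_eq,
    ENNReal.ofReal_tsum_of_nonneg (fun n => by positivity) hsum.summable]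
  refine tsum_congr fun n => ?_
  rw [poissonMeasure_singleton, ENNReal.ofReal_mul (by positivity), ENNReal.ofReal_pow hq]

variable {Ω : Type*} {Φ : Ω → Set Plane}

theorem count_union {B C : Set Plane} (hBC : Disjoint B C) (ω : Ω) :
    count Φ (B ∪ C) ω = count Φ B ω + count Φ C ω := by
  rw [count, Set.inter_union_distrib_left,
    Set.encard_union_eq (hBC.mono Set.inter_subset_right Set.inter_subset_right)]
  rfl

theorem count_eq_zero_iff {B : Set Plane} {ω : Ω} : count Φ B ω = 0 ↔ Disjoint (Φ ω) B := by
  rw [count, Set.encard_eq_zero, Set.disjoint_iff_inter_eq_empty]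

theorem measurable_count_sigmaPoints {B : Set Plane} (hB : MeasurableSet B) :
    Measurable[sigmaPoints Φ] (count Φ B) :=
  (comap_measurable _).mono
    (le_iSup (fun B : {B : Set Plane // MeasurableSet B} =>
      MeasurableSpace.comap (count Φ B.1) inferInstance) ⟨B, hB⟩) le_rfl

theorem measurableSet_disjoint_sigmaPoints {B : Set Plane} (hB : MeasurableSet B) :
    MeasurableSet[sigmaPoints Φ] {ω | Disjoint (Φ ω) B} := by
  simp_rw [← count_eq_zero_iff]
  exact measurable_count_sigmaPoints hB (measurableSet_singleton 0)

namespace IsPoissonProcess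

variable [MeasurableSpace Ω] {μ : Measure Ω} {lam : ℝ≥0} (h : IsPoissonProcess μ Φ lam)
include h

theorem sigmaPoints_le : sigmaPoints Φ ≤ ‹MeasurableSpace Ω› :=
  iSup_le fun B => (h.measurable_count B.1 B.2).comap_le

theorem toNat_count_eq_add {B C : Set Plane} (hB : Bornology.IsBounded B) (hCB : C ⊆ B)
    (ω : Ω) :
    (count Φ B ω).toNat = (count Φ C ω).toNat + (count Φ (B \ C) ω).toNat := by
  have hfin {D : Set Plane} (hD : D ⊆ B) : count Φ D ω ≠ ⊤ :=
    Set.encard_ne_top_iff.2 (h.locallyFinite ω D (hB.subset hD))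
  rw [← ENat.toNat_add (hfin hCB) (hfin Set.sdiff_subset), ← count_union Set.disjoint_sdiff_right,
    Set.union_sdiff_cancel hCB]

theorem indepFun_count {B C : Set Plane} (hB : MeasurableSet B) (hC : MeasurableSet C)
    (hBC : Disjoint B C) : IndepFun (count Φ B) (count Φ C) μ := by
  have hmeas : ∀ i, MeasurableSet (![B, C] i) := by simp [Fin.forall_fin_two, hB, hC]
  have hpair : Pairwise fun i j : Fin 2 => Disjoint (![B, C] i) (![B, C] j) := by
    simp [Pairwise, Fin.forall_fin_two, hBC, hBC.symm]
  have hindep := h.indep_count 2 ![B, C] hmeas hpair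
  exact hindep.indepFun (i := 0) (j := 1) (by decide)

theorem lintegral_mul_count {B C : Set Plane} (hB : MeasurableSet B) (hC : MeasurableSet C)
    (hBC : Disjoint B C) (f g : ℕ∞ → ℝ≥0∞) :
    ∫⁻ ω, f (count Φ B ω) * g (count Φ C ω) ∂μ =
      (∫⁻ ω, f (count Φ B ω) ∂μ) * ∫⁻ ω, g (count Φ C ω) ∂μ :=
  have hf : Measurable f := .of_discrete
  have hg : Measurable g := .of_discrete
  lintegral_mul_eq_lintegral_mul_lintegral_of_indepFun (hf.comp (h.measurable_count B hB))
    (hg.comp (h.measurable_count C hC)) ((h.indepFun_count hB hC hBC).comp hf hg)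

theorem lintegral_count {B : Set Plane} (hB : MeasurableSet B) (hvol : volume B ≠ ∞)
    (f : ℕ∞ → ℝ≥0∞) :
    ∫⁻ ω, f (count Φ B ω) ∂μ = ∫⁻ n : ℕ, f n ∂poissonMeasure (lam * (volume B).toNNReal) := by
  rw [(h.law_count B hB hvol).lintegral_comp Measurable.of_discrete.aemeasurable,
    lintegral_map .of_discrete .of_discrete]

theorem lintegral_pow_count {B : Set Plane} (hB : MeasurableSet B) (hvol : volume B ≠ ∞) {q : ℝ}
    (hq : 0 ≤ q) :
    ∫⁻ ω, ENNReal.ofReal q ^ (count Φ B ω).toNat ∂μ =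
      ENNReal.ofReal (Real.exp (-(lam * volume.real B * (1 - q)))) := by
  rw [h.lintegral_count hB hvol (fun n => ENNReal.ofReal q ^ n.toNat)]
  exact lintegral_pow_poissonMeasure _ hq

theorem measure_disjoint {B : Set Plane} (hB : MeasurableSet B) (hvol : volume B ≠ ∞) :
    μ {ω | Disjoint (Φ ω) B} = ENNReal.ofReal (Real.exp (-(lam * volume.real B))) := by
  have hcast : (Nat.cast : ℕ → ℕ∞) ⁻¹' {n | n = 0} = {0} := by
    ext n
    simp
  simp_rw [← count_eq_zero_iff]
  rw [(h.law_count B hB hvol).measure_eq (p := (· = 0)) .of_discrete,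
    Measure.map_apply .of_discrete .of_discrete, hcast, poissonMeasure_singleton, pow_zero,
    Nat.factorial_zero, Nat.cast_one, mul_one, div_one]
  rfl

theorem lintegral_count_mul_pow_count_self {B : Set Plane} (hB : MeasurableSet B)
    (hvol : volume B ≠ ∞) (q : ℝ≥0∞) :
    ∫⁻ ω, (count Φ B ω : ℝ≥0∞) * q ^ (count Φ B ω).toNat ∂μ =
      lam * volume B * q * ∫⁻ ω, q ^ (count Φ B ω).toNat ∂μ := by
  rw [h.lintegral_count hB hvol (fun n => (n : ℝ≥0∞) * q ^ n.toNat),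
    h.lintegral_count hB hvol (fun n => q ^ n.toNat)]
  simp only [ENat.toENNReal_coe, ENat.toNat_natCast]
  rw [lintegral_natCast_mul_poissonMeasure, ENNReal.coe_mul, ENNReal.coe_toNNReal hvol,
    mul_assoc _ q, ← lintegral_const_mul q .of_discrete]
  simp_rw [pow_succ']

theorem lintegral_count_mul_pow_count_of_disjoint [IsProbabilityMeasure μ] {B C : Set Plane}
    (hB : MeasurableSet B) (hC : MeasurableSet C) (hvol : volume C ≠ ∞) (hCB : Disjoint C B)
    (q : ℝ≥0∞) :
    ∫⁻ ω, (count Φ C ω : ℝ≥0∞) * q ^ (count Φ B ω).toNat ∂μ =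
      lam * volume C * ∫⁻ ω, q ^ (count Φ B ω).toNat ∂μ := by
  rw [h.lintegral_mul_count hC hB hCB (fun n => n) (fun n => q ^ n.toNat)]
  congr 1
  simpa using h.lintegral_count_mul_pow_count_self hC hvol 1

theorem lintegral_count_mul_pow_count_of_subset {B C : Set Plane} (hB : MeasurableSet B)
    (hBdd : Bornology.IsBounded B) (hC : MeasurableSet C) (hCB : C ⊆ B) (q : ℝ≥0∞) :
    ∫⁻ ω, (count Φ C ω : ℝ≥0∞) * q ^ (count Φ B ω).toNat ∂μ =
      lam * volume C * q * ∫⁻ ω, q ^ (count Φ B ω).toNat ∂μ := by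
  have hindep := h.lintegral_mul_count hC (hB.diff hC) Set.disjoint_sdiff_right
  simp_rw [h.toNat_count_eq_add hBdd hCB, pow_add, ← mul_assoc]
  rw [hindep (fun n => n * q ^ n.toNat) (fun n => q ^ n.toNat),
    hindep (fun n => q ^ n.toNat) (fun n => q ^ n.toNat),
    h.lintegral_count_mul_pow_count_self hC (hBdd.subset hCB).measure_lt_top.ne, mul_assoc]

/-- A point of `C ∩ B` already contributes a factor `q` to `q ^ (count Φ B ω).toNat`. Once the
points of `C \ B` are given this factor as well, the position of `C` relative to `B` plays no role:
the reduced Palm version of a Poisson process is the process itself. -/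
theorem lintegral_count_inter_add_count_sdiff [IsProbabilityMeasure μ] {B C : Set Plane}
    (hB : MeasurableSet B) (hBdd : Bornology.IsBounded B) (hC : MeasurableSet C)
    (hCvol : volume C ≠ ∞) (q : ℝ≥0∞) :
    ∫⁻ ω, ((count Φ (C ∩ B) ω : ℝ≥0∞) * q ^ (count Φ B ω).toNat +
        (count Φ (C \ B) ω : ℝ≥0∞) * q ^ ((count Φ B ω).toNat + 1)) ∂μ =
      lam * q * volume C * ∫⁻ ω, q ^ (count Φ B ω).toNat ∂μ := by
  have hmeas {D : Set Plane} (hD : MeasurableSet D) :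
      Measurable fun ω => (count Φ D ω : ℝ≥0∞) * q ^ (count Φ B ω).toNat :=
    .mul (Measurable.of_discrete.comp (h.measurable_count D hD))
      ((Measurable.of_discrete (f := fun n : ℕ∞ => q ^ n.toNat)).comp (h.measurable_count B hB))
  rw [lintegral_add_left (hmeas (hC.inter hB)),
    h.lintegral_count_mul_pow_count_of_subset hB hBdd (hC.inter hB) Set.inter_subset_right]
  simp_rw [pow_succ, ← mul_assoc]
  rw [lintegral_mul_const q (hmeas (hC.diff hB)),
    h.lintegral_count_mul_pow_count_of_disjoint hB (hC.diff hB)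
      (measure_ne_top_of_subset Set.sdiff_subset hCvol) Set.disjoint_sdiff_left,
    ← measure_inter_add_sdiff C hB]
  ring

end IsPoissonProcess

end Poisson

section DiskIntegral

theorem volume_real_closedBall (x : Plane) {r : ℝ} (hr : 0 ≤ r) :
    volume.real (Metric.closedBall x r) = Real.pi * r ^ 2 := by
  rw [Measure.real, EuclideanSpace.volume_closedBall_fin_two, ENNReal.toReal_mul,
    ENNReal.toReal_pow, ENNReal.toReal_ofReal hr, ENNReal.toReal_ofReal Real.pi_pos.le, mul_comm]

theorem setIntegral_ball_fun_norm (f : ℝ → ℝ) {η : ℝ} (hη : 0 ≤ η) :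
    ∫ y in Metric.ball (0 : Plane) η, f ‖y‖ = 2 * Real.pi * ∫ r in 0..η, r * f r := by
  classical
  have hball : volume.real (Metric.ball (0 : Plane) 1) = Real.pi := by
    simp [Measure.real, EuclideanSpace.volume_ball_fin_two, Real.pi_pos.le]
  have hind : (Metric.ball (0 : Plane) η).indicator (fun y => f ‖y‖) =
      fun y => (Set.Iio η).indicator f ‖y‖ := by
    ext y
    simp [Set.indicator_apply]
  have hmul (r : ℝ) : r ^ (Module.finrank ℝ Plane - 1) • (Set.Iio η).indicator f r =
      (Set.Iio η).indicator (fun r => r * f r) r := by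
    simp [Set.indicator_apply]
  rw [← integral_indicator measurableSet_ball, hind, integral_fun_norm_addHaar volume]
  simp_rw [hmul]
  rw [integral_indicator measurableSet_Iio, Measure.restrict_restrict measurableSet_Iio,
    Set.inter_comm, Set.Ioi_inter_Iio, ← integral_Ioc_eq_integral_Ioo,
    ← intervalIntegral.integral_of_le hη, hball, finrank_euclideanSpace_fin, nsmul_eq_mul,
    smul_eq_mul, Nat.cast_ofNat, mul_assoc]

theorem integral_mul_exp_neg_mul_sq {a : ℝ} (ha : a ≠ 0) (η : ℝ) :
    ∫ r in 0..η, r * Real.exp (-(a * r ^ 2)) = (1 - Real.exp (-(a * η ^ 2))) / (2 * a) := by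
  have hderiv (r : ℝ) : HasDerivAt (fun r : ℝ => -Real.exp (-(a * r ^ 2)) / (2 * a))
      (r * Real.exp (-(a * r ^ 2))) r := by
    have h := (((((hasDerivAt_id r).pow 2).const_mul a).neg.exp).neg).div_const (2 * a)
    refine h.congr_deriv ?_
    simp only [Pi.neg_apply, Pi.pow_apply, id_eq, Nat.cast_ofNat]
    field_simp
    norm_num
  rw [intervalIntegral.integral_eq_sub_of_hasDerivAt (fun r _ => hderiv r)
    (Continuous.intervalIntegrable (by fun_prop) _ _)]
  simp only [ne_eq, OfNat.ofNat_ne_zero, not_false_eq_true, zero_pow, mul_zero, neg_zero,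
    Real.exp_zero]
  field_simp
  ring

theorem setLIntegral_ball_exp_neg_mul_norm_sq {c η : ℝ} (hc : c ≠ 0) (hη : 0 ≤ η) :
    ∫⁻ y in Metric.ball (0 : Plane) η, ENNReal.ofReal (Real.exp (-(c * Real.pi * ‖y‖ ^ 2))) =
      ENNReal.ofReal ((1 - Real.exp (-(c * Real.pi * η ^ 2))) / c) := by
  have hcont : Continuous fun y : Plane => Real.exp (-(c * Real.pi * ‖y‖ ^ 2)) := by fun_prop
  have hint : IntegrableOn (fun y : Plane => Real.exp (-(c * Real.pi * ‖y‖ ^ 2)))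
      (Metric.ball 0 η) :=
    (hcont.continuousOn.integrableOn_compact (isCompact_closedBall (0 : Plane) η)).mono_set
      Metric.ball_subset_closedBall
  rw [← ofReal_integral_eq_lintegral_ofReal hint (ae_of_all _ fun _ => (Real.exp_pos _).le),
    setIntegral_ball_fun_norm (fun r => Real.exp (-(c * Real.pi * r ^ 2))) hη,
    integral_mul_exp_neg_mul_sq (mul_ne_zero hc Real.pi_ne_zero)]
  congr 1
  field_simp

end DiskIntegral

section Counting

theorem tsum_indicator_pow_ncard_insert {ι : Type*} (I : Set ι) {J : Set ι} (hJ : J.Finite)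
    (q : ℝ≥0∞) :
    ∑' i, I.indicator (fun i => q ^ (insert i J).ncard) i =
      (I ∩ J).encard * q ^ J.ncard + (I \ J).encard * q ^ (J.ncard + 1) := by
  classical
  have hsplit (i : ι) : I.indicator (fun i => q ^ (insert i J).ncard) i =
      (I ∩ J).indicator (fun _ => q ^ J.ncard) i +
        (I \ J).indicator (fun _ => q ^ (J.ncard + 1)) i := by
    by_cases hi : i ∈ J
    · simp [Set.indicator_apply, hi, Set.insert_eq_of_mem]
    · simp [Set.indicator_apply, hi, Set.ncard_insert_of_notMem hi hJ]
  simp_rw [hsplit]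
  rw [ENNReal.tsum_add, ← tsum_subtype, ← tsum_subtype, ENNReal.tsum_set_const,
    ENNReal.tsum_set_const]

theorem measurable_of_measurableSet_mem {Ω ι : Type*} {_ : MeasurableSpace Ω} {S : Ω → Set ι}
    (h : ∀ i, MeasurableSet {ω | i ∈ S ω}) : Measurable S :=
  measurable_set_iff.2 fun i => measurableSet_setOfPred.1 (h i)

theorem measurable_insert {ι : Type*} (i : ι) : Measurable (insert i : Set ι → Set ι) := by
  refine measurable_of_measurableSet_mem fun j => ?_
  by_cases hji : j = i
  · simp [hji]
  · simpa [hji] using measurableSet_mem j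

theorem lintegral_encard {Ω ι : Type*} [MeasurableSpace Ω] [Countable ι] (μ : Measure Ω)
    {S : Ω → Set ι} (hS : Measurable S) :
    ∫⁻ ω, ((S ω).encard : ℝ≥0∞) ∂μ = ∑' i, μ {ω | i ∈ S ω} := by
  have hmem (i : ι) : MeasurableSet {ω | i ∈ S ω} := hS (measurableSet_mem i)
  have hsum (ω : Ω) :
      ((S ω).encard : ℝ≥0∞) = ∑' i, {ω | i ∈ S ω}.indicator (1 : Ω → ℝ≥0∞) ω := by
    rw [← ENNReal.tsum_set_one, tsum_subtype (S ω) fun _ => (1 : ℝ≥0∞)]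
    rfl
  simp_rw [hsum]
  rw [lintegral_tsum fun i => (measurable_one.indicator (hmem i)).aemeasurable]
  exact tsum_congr fun i => lintegral_indicator_one (hmem i)

end Counting

section IndependentThinning

theorem setLIntegral_of_indep {Ω : Type*} {m₁ m₂ m0 : MeasurableSpace Ω} {μ : Measure Ω}
    (h₁ : m₁ ≤ m0) (h₂ : m₂ ≤ m0) (hindep : Indep m₁ m₂ μ) {f : Ω → ℝ≥0∞} (hf : Measurable[m₁] f)
    {F : Set Ω} (hF : MeasurableSet[m₂] F) :
    ∫⁻ ω in F, f ω ∂μ = (∫⁻ ω, f ω ∂μ) * μ F := by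
  have hprod := lintegral_mul_eq_lintegral_mul_lintegral_of_independent_measurableSpace h₁ h₂ hindep
    hf ((@measurable_one _ _ _ m₂ _).indicator hF)
  rw [lintegral_indicator_one (h₂ _ hF)] at hprod
  rw [← hprod, ← lintegral_indicator (h₂ _ hF)]
  congr 1 with ω
  by_cases hω : ω ∈ F <;> simp [hω]

variable {Ω ι : Type*} {m m0 : MeasurableSpace Ω} {μ : Measure Ω} {tx : ι → Ω → Bool}

theorem measurableSet_forall_mem_eq_false (s : Finset ι) :
    MeasurableSet[⨆ i, MeasurableSpace.comap (tx i) inferInstance]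
      {ω | ∀ i ∈ s, tx i ω = false} := by
  have hset : {ω | ∀ i ∈ s, tx i ω = false} = ⋂ i ∈ s, tx i ⁻¹' {false} := by
    ext ω
    simp
  rw [hset]
  exact s.measurableSet_biInter fun i _ =>
    le_iSup (fun i => MeasurableSpace.comap (tx i) inferInstance) i _ ⟨{false}, .of_discrete, rfl⟩

theorem measure_forall_mem_eq_false {q : ℝ≥0∞} (hiid : iIndepFun tx μ)
    (hq : ∀ i, μ {ω | tx i ω = false} = q) (s : Finset ι) :
    μ {ω | ∀ i ∈ s, tx i ω = false} = q ^ s.card := by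
  have hset : {ω | ∀ i ∈ s, tx i ω = false} = ⋂ i ∈ s, tx i ⁻¹' {false} := by
    ext ω
    simp
  rw [hset, hiid.meas_biInter fun i _ => ⟨{false}, .of_discrete, rfl⟩]
  exact (Finset.prod_congr rfl fun i _ => hq i).trans (Finset.prod_const q)

theorem measure_inter_forall_mem_finset_eq_false {q : ℝ≥0∞} (hiid : iIndepFun tx μ)
    (hq : ∀ i, μ {ω | tx i ω = false} = q)
    (hindep : Indep (⨆ i, MeasurableSpace.comap (tx i) inferInstance) m μ)
    {F : Set Ω} (hF : MeasurableSet[m] F) (s : Finset ι) :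
    μ (F ∩ {ω | ∀ i ∈ s, tx i ω = false}) = q ^ s.card * μ F := by
  rw [Set.inter_comm, (Indep_iff _ _ μ).1 hindep _ _ (measurableSet_forall_mem_eq_false s) hF,
    measure_forall_mem_eq_false hiid hq]

theorem measure_inter_forall_mem_eq_false [Countable ι] (hm : m ≤ m0)
    (htx : ∀ i, Measurable (tx i)) {q : ℝ≥0∞} (hiid : iIndepFun tx μ)
    (hq : ∀ i, μ {ω | tx i ω = false} = q)
    (hindep : Indep (⨆ i, MeasurableSpace.comap (tx i) inferInstance) m μ)
    {E : Set Ω} (hE : MeasurableSet[m] E) {S : Ω → Set ι} (hS : Measurable[m] S)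
    (hfin : ∀ ω, (S ω).Finite) :
    μ (E ∩ {ω | ∀ i ∈ S ω, tx i ω = false}) = ∫⁻ ω in E, q ^ (S ω).ncard ∂μ := by
  let fiber (s : Finset ι) : Set Ω := E ∩ S ⁻¹' {↑s}
  have hfiber (s : Finset ι) : MeasurableSet[m] (fiber s) :=
    hE.inter (hS (measurableSet_singleton _))
  have hmarks (s : Finset ι) : MeasurableSet {ω | ∀ i ∈ s, tx i ω = false} :=
    iSup_le (fun i => (htx i).comap_le) _ (measurableSet_forall_mem_eq_false s)
  have hcover : E = ⋃ s, fiber s := by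
    rw [← Set.inter_iUnion, eq_comm, Set.inter_eq_left]
    exact fun ω _ => Set.mem_iUnion.2 ⟨(hfin ω).toFinset, (hfin ω).coe_toFinset.symm⟩
  have hdisj : Pairwise (Function.onFun Disjoint fiber) := fun s t hst =>
    Set.disjoint_left.2 fun ω hs ht => hst (Finset.coe_injective (hs.2.symm.trans ht.2))
  have hsplit : E ∩ {ω | ∀ i ∈ S ω, tx i ω = false} =
      ⋃ s, fiber s ∩ {ω | ∀ i ∈ s, tx i ω = false} := by
    conv_lhs => rw [hcover, Set.iUnion_inter]
    refine Set.iUnion_congr fun s => Set.ext fun ω => and_congr_right fun hω => ?_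
    simp only [Set.mem_ofPred_eq, show S ω = s from hω.2, Finset.mem_coe]
  have hterm (s : Finset ι) : μ (fiber s ∩ {ω | ∀ i ∈ s, tx i ω = false}) =
      ∫⁻ ω in fiber s, q ^ (S ω).ncard ∂μ := by
    have hcard : ∀ ω ∈ fiber s, q ^ (S ω).ncard = q ^ s.card := fun ω hω => by
      rw [show S ω = s from hω.2, Set.ncard_coe_finset]
    rw [setLIntegral_congr_fun (hm _ (hfiber s)) hcard, setLIntegral_const,
      measure_inter_forall_mem_finset_eq_false hiid hq hindep (hfiber s)]
  rw [hsplit, measure_iUnion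
    (fun s t hst => (hdisj hst).mono Set.inter_subset_left Set.inter_subset_left)
    (fun s => (hm _ (hfiber s)).inter (hmarks s))]
  conv_rhs => rw [hcover]
  rw [lintegral_iUnion (fun s => hm _ (hfiber s)) hdisj]
  exact tsum_congr hterm

end IndependentThinning

section RandomClosedSets

variable {X : Type*}

theorem isClosed_of_finite_inter_isBounded [MetricSpace X] {S : Set X}
    (hS : ∀ B, Bornology.IsBounded B → (S ∩ B).Finite) : IsClosed S := by
  refine isClosed_of_closure_subset fun x hx => ?_
  have hx' : x ∈ closure (S ∩ Metric.ball x 1) := by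
    rw [Set.inter_comm]
    exact Metric.isOpen_ball.inter_closure ⟨Metric.mem_ball_self one_pos, hx⟩
  exact ((hS _ Metric.isBounded_ball).isClosed.closure_subset hx').1

variable [PseudoMetricSpace X]

theorem exists_lt_disjoint_ball [ProperSpace X] {S : Set X} (hS : IsClosed S) {x : X} {r : ℝ}
    (h : Disjoint S (Metric.closedBall x r)) : ∃ ρ > r, Disjoint S (Metric.ball x ρ) := by
  rcases S.eq_empty_or_nonempty with rfl | hne
  · exact ⟨r + 1, by linarith, Set.empty_disjoint _⟩
  obtain ⟨y, hy, hdist⟩ := hS.exists_infDist_eq_dist hne x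
  refine ⟨Metric.infDist x S, ?_, ?_⟩
  · rw [hdist, dist_comm]
    exact not_le.1 (Set.disjoint_left.1 h hy)
  · exact (Metric.disjoint_ball_infDist).symm

theorem disjoint_closedBall_iff_exists_denseSeq [ProperSpace X] [Nonempty X] {S : Set X}
    (hS : IsClosed S) {x : X} {r : ℝ} :
    Disjoint S (Metric.closedBall x r) ↔
      ∃ (n : ℕ) (ρ : ℚ), dist x (TopologicalSpace.denseSeq X n) + r < ρ ∧
        Disjoint S (Metric.ball (TopologicalSpace.denseSeq X n) ρ) := by
  constructor
  · intro h
    obtain ⟨ρ, hρ, hdisj⟩ := exists_lt_disjoint_ball hS h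
    obtain ⟨n, hn⟩ := (TopologicalSpace.denseRange_denseSeq X).exists_dist_lt x
      (by linarith : 0 < (ρ - r) / 2)
    obtain ⟨t, hrt, htρ⟩ := exists_rat_btwn
      (by linarith : dist x (TopologicalSpace.denseSeq X n) + r <
        ρ - dist x (TopologicalSpace.denseSeq X n))
    refine ⟨n, t, hrt, hdisj.mono_right (Metric.ball_subset_ball' ?_)⟩
    rw [dist_comm]
    linarith
  · rintro ⟨n, ρ, hlt, hdisj⟩
    exact hdisj.mono_right (Metric.closedBall_subset_ball' (by linarith))

theorem measurableSet_disjoint_closedBall [ProperSpace X] [MeasurableSpace X]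
    [OpensMeasurableSpace X] {Ω : Type*} [MeasurableSpace Ω] {S : Ω → Set X}
    (hclosed : ∀ ω, IsClosed (S ω))
    (hball : ∀ a ρ, MeasurableSet {ω | Disjoint (S ω) (Metric.ball a ρ)})
    {c : Ω → X} (hc : Measurable c) {r : Ω → ℝ} (hr : Measurable r) :
    MeasurableSet {ω | Disjoint (S ω) (Metric.closedBall (c ω) (r ω))} := by
  rcases isEmpty_or_nonempty X
  · simp [Set.eq_empty_of_isEmpty]
  simp_rw [disjoint_closedBall_iff_exists_denseSeq (hclosed _), Set.ofPred_exists]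
  refine .iUnion fun n => .iUnion fun ρ => .inter ?_ (hball _ _)
  exact measurableSet_lt ((hc.dist measurable_const).add hr) measurable_const

end RandomClosedSets

section CampbellMeasure

variable {Ω E Θ ι : Type*} [MeasurableSpace Ω] [MeasurableSpace E] [mΘ : MeasurableSpace Θ]
  {μ : Measure Ω} {S : Ω → Set ι} {x : ι → Ω → E} {Z : Ω → Θ}

/-- The Campbell measure of the random points `x i ω`, `i ∈ S ω`, in the random environment `Z`:
its value at `C ×ˢ D` is the mean number of the points that lie in `C`, on the event `Z ∈ D`. -/
noncomputable def campbellMeasure (μ : Measure Ω) (S : Ω → Set ι) (x : ι → Ω → E) (Z : Ω → Θ) :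
    Measure (E × Θ) :=
  Measure.sum fun i => (μ.restrict {ω | i ∈ S ω}).map fun ω => (x i ω, Z ω)

theorem campbellMeasure_apply [Countable ι] (hS : Measurable S) (hx : ∀ i, Measurable (x i))
    (hZ : Measurable Z) {H : Set (E × Θ)} (hH : MeasurableSet H) :
    campbellMeasure μ S x Z H =
      ∫⁻ ω, ({i ∈ S ω | (x i ω, Z ω) ∈ H}.encard : ℝ≥0∞) ∂μ := by
  have hpre (i : ι) : MeasurableSet ((fun ω => (x i ω, Z ω)) ⁻¹' H) :=
    ((hx i).prodMk hZ) hH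
  have hmeas : Measurable fun ω => {i ∈ S ω | (x i ω, Z ω) ∈ H} :=
    measurable_of_measurableSet_mem fun i => (hS (measurableSet_mem i)).inter (hpre i)
  rw [lintegral_encard μ hmeas, campbellMeasure, Measure.sum_apply _ hH]
  refine tsum_congr fun i => ?_
  rw [Measure.map_apply ((hx i).prodMk hZ) hH, Measure.restrict_apply (hpre i), Set.inter_comm]
  rfl

theorem campbellMeasure_prod [Countable ι] (hS : Measurable S) (hx : ∀ i, Measurable (x i))
    (hZ : Measurable Z) {C : Set E} (hC : MeasurableSet C) {D : Set Θ} (hD : MeasurableSet D) :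
    campbellMeasure μ S x Z (C ×ˢ D) =
      ∫⁻ ω in Z ⁻¹' D, ({i ∈ S ω | x i ω ∈ C}.encard : ℝ≥0∞) ∂μ := by
  rw [campbellMeasure_apply hS hx hZ (hC.prod hD), ← lintegral_indicator (hZ hD)]
  congr 1 with ω
  by_cases hω : Z ω ∈ D <;> simp [Set.indicator, hω]

theorem campbellMeasure_eq_prod [IsFiniteMeasure μ] {Λ : Measure E} [SigmaFinite Λ]
    {𝓓 : Set (Set Θ)} (hgen : mΘ = .generateFrom 𝓓) (hpi : IsPiSystem 𝓓)
    (huniv : Set.univ ∈ 𝓓) (hZ : Measurable Z)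
    (hprod : ∀ C, MeasurableSet C → ∀ D ∈ 𝓓,
      campbellMeasure μ S x Z (C ×ˢ D) = Λ C * μ (Z ⁻¹' D)) :
    campbellMeasure μ S x Z = Λ.prod (μ.map Z) := by
  have hmeas {D : Set Θ} (hD : D ∈ 𝓓) : MeasurableSet D :=
    hgen ▸ MeasurableSpace.measurableSet_generateFrom hD
  have hspan : (μ.map Z).FiniteSpanningSetsIn 𝓓 :=
    ⟨fun _ => Set.univ, fun _ => huniv, fun _ => measure_lt_top _ _, Set.iUnion_const _⟩
  refine (Measure.prod_eq_generateFrom MeasurableSpace.generateFrom_measurableSet hgen.symm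
    MeasurableSpace.isPiSystem_measurableSet hpi Λ.toFiniteSpanningSetsIn hspan
    fun C hC D hD => ?_).symm
  rw [hprod C hC D hD, Measure.map_apply hZ (hmeas hD)]

theorem lintegral_encard_eq_lintegral_measure [Countable ι] [IsFiniteMeasure μ] {Λ : Measure E}
    [SigmaFinite Λ] {𝓓 : Set (Set Θ)} (hgen : mΘ = .generateFrom 𝓓) (hpi : IsPiSystem 𝓓)
    (huniv : Set.univ ∈ 𝓓) (hS : Measurable S) (hx : ∀ i, Measurable (x i)) (hZ : Measurable Z)
    (hprod : ∀ C, MeasurableSet C → ∀ D ∈ 𝓓,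
      ∫⁻ ω in Z ⁻¹' D, ({i ∈ S ω | x i ω ∈ C}.encard : ℝ≥0∞) ∂μ = Λ C * μ (Z ⁻¹' D))
    {H : Set (E × Θ)} (hH : MeasurableSet H) :
    ∫⁻ ω, ({i ∈ S ω | (x i ω, Z ω) ∈ H}.encard : ℝ≥0∞) ∂μ =
      ∫⁻ y, μ {ω | (y, Z ω) ∈ H} ∂Λ := by
  have hmeas {D : Set Θ} (hD : D ∈ 𝓓) : MeasurableSet D :=
    hgen ▸ MeasurableSpace.measurableSet_generateFrom hD
  rw [← campbellMeasure_apply hS hx hZ hH, campbellMeasure_eq_prod hgen hpi huniv hZ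
    fun C hC D hD => (campbellMeasure_prod hS hx hZ hC (hmeas hD)).trans (hprod C hC D hD),
    Measure.prod_apply hH]
  exact lintegral_congr fun y => Measure.map_apply hZ (measurable_prodMk_left hH)

end CampbellMeasure

section SecureRegion

theorem securelyConnects_insert_self_iff {T D : Set Plane} {η βl βe : ℝ} {x y : Plane} :
    SecurelyConnects (insert x T) D η βl βe x y ↔
      dist x y < η ∧ Disjoint (T \ {x}) (Metric.closedBall y (βl * dist x y)) ∧
        Disjoint D (Metric.closedBall x (βe * dist x y)) := by
  simp_rw [Set.disjoint_left, dist_eq_norm]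
  constructor
  · rintro ⟨hη, hT, hD⟩
    exact ⟨hη, fun z hz => hT z (Set.mem_insert_of_mem x hz.1) hz.2, hD⟩
  · rintro ⟨hη, hT, hD⟩
    exact ⟨hη, fun z hz hzx => hT ⟨Set.mem_of_mem_insert_of_ne hz hzx, hzx⟩, hD⟩

theorem measurableSet_securelyConnects {Ω : Type*} [mΩ : MeasurableSpace Ω] {T D : Ω → Set Plane}
    (hTfin : ∀ ω B, Bornology.IsBounded B → (T ω ∩ B).Finite)
    (hDfin : ∀ ω B, Bornology.IsBounded B → (D ω ∩ B).Finite)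
    (hT : ∀ B, Bornology.IsBounded B → MeasurableSet B → MeasurableSet {ω | Disjoint (T ω) B})
    (hD : ∀ B, Bornology.IsBounded B → MeasurableSet B → MeasurableSet {ω | Disjoint (D ω) B})
    (η βl βe : ℝ) (x : Plane) :
    MeasurableSet {z : Plane × Ω |
      SecurelyConnects (insert x (T z.2)) (D z.2) η βl βe x z.1} := by
  simp_rw [securelyConnects_insert_self_iff]
  have hdist : Measurable fun z : Plane × Ω => dist x z.1 := measurable_const.dist measurable_fst
  refine (measurableSet_lt hdist measurable_const).inter (.inter ?_ ?_)
  · refine measurableSet_disjoint_closedBall (S := fun z : Plane × Ω => T z.2 \ {x})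
      (fun z => isClosed_of_finite_inter_isBounded fun B hB => (hTfin z.2 B hB).subset
        (Set.inter_subset_inter_left _ Set.sdiff_subset)) (fun a ρ => ?_) measurable_fst
      (measurable_const.mul hdist)
    simp_rw [disjoint_sdiff_comm]
    exact measurable_snd (hT _ (Metric.isBounded_ball.subset Set.sdiff_subset)
      (measurableSet_ball.diff (measurableSet_singleton x)))
  · exact measurableSet_disjoint_closedBall (S := fun z : Plane × Ω => D z.2)
      (fun z => isClosed_of_finite_inter_isBounded (hDfin z.2))
      (fun a ρ => measurable_snd (hD _ Metric.isBounded_ball measurableSet_ball)) measurable_const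
      (measurable_const.mul hdist)

end SecureRegion

namespace SlottedAloha

variable {Ω : Type*} [MeasurableSpace Ω] {μ : Measure Ω} {Φl Φe : Ω → Set Plane} {p : ℝ}
  (A : SlottedAloha μ Φl Φe p)

/-- The indices of the nodes in `B`. -/
def indices (B : Set Plane) (ω : Ω) : Set ℕ := {i | (i : ℕ∞) < A.num ω ∧ A.node i ω ∈ B}

/-- The indices of the nodes in `B` that receive in slot `k`. -/
def receiverIndices (k : ℕ) (B : Set Plane) (ω : Ω) : Set ℕ :=
  {i ∈ A.indices B ω | A.tx k i ω = false}

section Indices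

variable {A} {B : Set Plane} {k : ℕ} {ω : Ω}

theorem image_indices : (A.node · ω) '' A.indices B ω = Φl ω ∩ B := by
  ext x
  rw [A.nodes_eq ω]
  constructor
  · rintro ⟨i, ⟨hi, hB⟩, rfl⟩
    exact ⟨⟨i, hi, rfl⟩, hB⟩
  · rintro ⟨⟨i, hi, rfl⟩, hB⟩
    exact ⟨i, ⟨hi, hB⟩, rfl⟩

theorem injOn_node_indices : Set.InjOn (A.node · ω) (A.indices B ω) :=
  fun i hi j hj h => A.node_injective ω i j hi.1 hj.1 h

theorem encard_indices : (A.indices B ω).encard = count Φl B ω := by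
  rw [count, ← image_indices, injOn_node_indices.encard_image]

theorem ncard_indices : (A.indices B ω).ncard = (count Φl B ω).toNat := by
  rw [Set.ncard, encard_indices]

theorem indices_inter_indices (C : Set Plane) :
    A.indices C ω ∩ A.indices B ω = A.indices (C ∩ B) ω := by
  ext i
  exact and_and_left.symm

theorem indices_sdiff_indices (C : Set Plane) :
    A.indices C ω \ A.indices B ω = A.indices (C \ B) ω := by
  ext i
  simp only [indices, Set.mem_sdiff, Set.mem_ofPred_eq]
  tauto

theorem disjoint_transmitters_iff :
    Disjoint (A.transmitters k ω) B ↔ ∀ i ∈ A.indices B ω, A.tx k i ω = false := by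
  rw [Set.disjoint_left]
  constructor
  · intro h i hi
    by_contra htx
    exact h ⟨i, hi.1, Bool.eq_true_of_not_eq_false htx, rfl⟩ hi.2
  · rintro h _ ⟨i, hi, htx, rfl⟩ hB
    exact absurd (h i ⟨hi, hB⟩) (by simp [htx])

theorem image_receiverIndices :
    (A.node · ω) '' A.receiverIndices k B ω = A.receivers k ω ∩ B := by
  ext y
  constructor
  · rintro ⟨i, ⟨hi, htx⟩, rfl⟩
    obtain ⟨hl, hB⟩ := image_indices.subset ⟨i, hi, rfl⟩
    refine ⟨⟨hl, ?_⟩, hB⟩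
    rintro ⟨j, hj, hjtx, hji⟩
    rw [A.node_injective ω j i hj hi.1 hji, htx] at hjtx
    exact Bool.false_ne_true hjtx
  · rintro ⟨⟨hl, ht⟩, hB⟩
    obtain ⟨i, hi, rfl⟩ := (image_indices (A := A)).superset ⟨hl, hB⟩
    refine ⟨i, ⟨hi, ?_⟩, rfl⟩
    by_contra htx
    exact ht ⟨i, hi.1, Bool.eq_true_of_not_eq_false htx, rfl⟩

theorem transmitters_subset : A.transmitters k ω ⊆ Φl ω := by
  rintro _ ⟨i, hi, -, rfl⟩
  rw [A.nodes_eq ω]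
  exact ⟨i, hi, rfl⟩

end Indices

/-- The σ-algebra generated by the positions of the nodes and of the eavesdroppers. -/
@[reducible] noncomputable def sigmaPositions : MeasurableSpace Ω :=
  MeasurableSpace.comap A.num inferInstance ⊔
    (⨆ i : ℕ, MeasurableSpace.comap (A.node i) inferInstance) ⊔ sigmaPoints Φe

theorem sigmaPositions_le {lamE : ℝ≥0} (hΦe : IsPoissonProcess μ Φe lamE) :
    A.sigmaPositions ≤ ‹MeasurableSpace Ω› :=
  sup_le (sup_le A.measurable_num.comap_le (iSup_le fun i => (A.measurable_node i).comap_le))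
    hΦe.sigmaPoints_le

theorem measurable_indices {B : Set Plane} (hB : MeasurableSet B) :
    Measurable[A.sigmaPositions] (A.indices B) := by
  have hnum : Measurable[A.sigmaPositions] A.num :=
    (comap_measurable _).mono (le_sup_left.trans le_sup_left) le_rfl
  have hnode (i : ℕ) : Measurable[A.sigmaPositions] (A.node i) :=
    (comap_measurable _).mono (((le_iSup (fun i : ℕ =>
      MeasurableSpace.comap (A.node i) inferInstance) i).trans le_sup_right).trans le_sup_left)
      le_rfl
  exact measurable_of_measurableSet_mem fun i =>
    (hnum (.of_discrete (s := Set.Ioi (i : ℕ∞)))).inter (hnode i hB)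

theorem finite_indices {lam : ℝ≥0} (hΦl : IsPoissonProcess μ Φl lam) {B : Set Plane}
    (hB : Bornology.IsBounded B) (ω : Ω) : (A.indices B ω).Finite := by
  rw [← Set.encard_ne_top_iff, encard_indices]
  exact Set.encard_ne_top_iff.2 (hΦl.locallyFinite ω B hB)

section Thinning

variable {lamL lamE : ℝ≥0}

theorem measurableSet_disjoint_transmitters {B : Set Plane} (hB : MeasurableSet B) (k : ℕ) :
    MeasurableSet {ω | Disjoint (A.transmitters k ω) B} := by
  simp_rw [disjoint_transmitters_iff, imp_iff_not_or, Set.ofPred_forall]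
  have hmem (i : ℕ) : MeasurableSet {ω | i ∈ A.indices B ω} :=
    (A.measurable_num (.of_discrete (s := Set.Ioi (i : ℕ∞)))).inter (A.measurable_node i hB)
  exact .iInter fun i => (hmem i).compl.union (A.measurable_tx k i (measurableSet_singleton false))

theorem measurable_receiverIndices (hΦe : IsPoissonProcess μ Φe lamE) {B : Set Plane}
    (hB : MeasurableSet B) (k : ℕ) : Measurable (A.receiverIndices k B) :=
  measurable_of_measurableSet_mem fun i =>
    MeasurableSet.inter (A.sigmaPositions_le hΦe _ (A.measurable_indices hB (measurableSet_mem i)))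
      (A.measurable_tx k i (measurableSet_singleton false))

variable [IsProbabilityMeasure μ]

theorem measure_tx_eq_false (hp : 0 ≤ p) (k i : ℕ) :
    μ {ω | A.tx k i ω = false} = ENNReal.ofReal (1 - p) := by
  have htrue : MeasurableSet {ω | A.tx k i ω = true} :=
    A.measurable_tx k i (measurableSet_singleton true)
  have hcompl : {ω | A.tx k i ω = false} = {ω | A.tx k i ω = true}ᶜ := by
    ext ω
    simp
  rw [hcompl, prob_compl_eq_one_sub htrue, A.prob_tx, ENNReal.ofReal_sub _ hp, ENNReal.ofReal_one]

theorem measure_inter_forall_mem_tx_eq_false (hp : 0 ≤ p) (hΦe : IsPoissonProcess μ Φe lamE)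
    (k : ℕ) {E : Set Ω} (hE : MeasurableSet[A.sigmaPositions] E) {S : Ω → Set ℕ}
    (hS : Measurable[A.sigmaPositions] S) (hfin : ∀ ω, (S ω).Finite) :
    μ (E ∩ {ω | ∀ i ∈ S ω, A.tx k i ω = false}) =
      ∫⁻ ω in E, ENNReal.ofReal (1 - p) ^ (S ω).ncard ∂μ := by
  have hiid : iIndepFun (A.tx k) μ := by
    have hslot := A.indep_tx.precomp (g := Prod.mk k) (Prod.mk_right_injective k)
    exact hslot
  refine measure_inter_forall_mem_eq_false (A.sigmaPositions_le hΦe) (A.measurable_tx k)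
    hiid (A.measure_tx_eq_false hp k)
    (indep_of_indep_of_le_left A.indep_positions ?_) hE hS hfin
  exact iSup_le fun i =>
    le_iSup (fun q : ℕ × ℕ => MeasurableSpace.comap (A.tx q.1 q.2) inferInstance) (k, i)

theorem measure_disjoint_transmitters_inter (hp : 0 ≤ p) (hΦl : IsPoissonProcess μ Φl lamL)
    (hΦe : IsPoissonProcess μ Φe lamE) (hindep : Indep (sigmaPoints Φl) (sigmaPoints Φe) μ)
    {B : Set Plane} (hB : MeasurableSet B) (hBdd : Bornology.IsBounded B) {F : Set Ω}
    (hF : MeasurableSet[sigmaPoints Φe] F) (k : ℕ) :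
    μ ({ω | Disjoint (A.transmitters k ω) B} ∩ F) =
      (∫⁻ ω, ENNReal.ofReal (1 - p) ^ (count Φl B ω).toNat ∂μ) * μ F := by
  have hpow : Measurable[sigmaPoints Φl] fun ω =>
      ENNReal.ofReal (1 - p) ^ (count Φl B ω).toNat :=
    (Measurable.of_discrete (f := fun n : ℕ∞ => ENNReal.ofReal (1 - p) ^ n.toNat)).comp
      (measurable_count_sigmaPoints hB)
  rw [← setLIntegral_of_indep hΦl.sigmaPoints_le hΦe.sigmaPoints_le hindep hpow hF, Set.inter_comm]
  simp_rw [disjoint_transmitters_iff, ← ncard_indices (A := A)]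
  exact A.measure_inter_forall_mem_tx_eq_false hp hΦe k (le_sup_right (α := MeasurableSpace Ω) _ hF)
    (A.measurable_indices hB) (A.finite_indices hΦl hBdd)

theorem measure_mem_receiverIndices_inter (hp : 0 ≤ p) (hΦl : IsPoissonProcess μ Φl lamL)
    (hΦe : IsPoissonProcess μ Φe lamE) {B C : Set Plane} (hB : MeasurableSet B)
    (hBdd : Bornology.IsBounded B) (hC : MeasurableSet C) {F : Set Ω}
    (hF : MeasurableSet[sigmaPoints Φe] F) (k i : ℕ) :
    μ ({ω | i ∈ A.receiverIndices k C ω} ∩ ({ω | Disjoint (A.transmitters k ω) B} ∩ F)) =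
      ∫⁻ ω in F, (A.indices C ω).indicator
        (fun i => ENNReal.ofReal (1 - p) ^ (insert i (A.indices B ω)).ncard) i ∂μ := by
  have hmem : MeasurableSet[A.sigmaPositions] {ω | i ∈ A.indices C ω} :=
    A.measurable_indices hC (measurableSet_mem i)
  have hF' : MeasurableSet[A.sigmaPositions] F := le_sup_right (α := MeasurableSpace Ω) _ hF
  have hinsert : Measurable[A.sigmaPositions] fun ω => insert i (A.indices B ω) :=
    (measurable_insert i).comp (A.measurable_indices hB)
  have hset : {ω | i ∈ A.receiverIndices k C ω} ∩ ({ω | Disjoint (A.transmitters k ω) B} ∩ F) =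
      ({ω | i ∈ A.indices C ω} ∩ F) ∩
        {ω | ∀ j ∈ insert i (A.indices B ω), A.tx k j ω = false} := by
    ext ω
    simp only [receiverIndices, disjoint_transmitters_iff, Set.mem_inter_iff, Set.mem_ofPred_eq,
      Set.forall_mem_insert]
    tauto
  rw [hset, A.measure_inter_forall_mem_tx_eq_false hp hΦe k (hmem.inter hF') hinsert
    fun ω => (A.finite_indices hΦl hBdd ω).insert i,
    ← setLIntegral_indicator (A.sigmaPositions_le hΦe _ hmem)]
  rfl

/-- Conditionally on the positions, all the nodes with indices in `insert i (indices B)` have to be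
silent, and the factor `1 - p` brought by the node `i` does not depend on whether it lies in `B`. -/
theorem setLIntegral_encard_receiverIndices (hp : 0 ≤ p) (hΦl : IsPoissonProcess μ Φl lamL)
    (hΦe : IsPoissonProcess μ Φe lamE) (hindep : Indep (sigmaPoints Φl) (sigmaPoints Φe) μ)
    {B C : Set Plane} (hB : MeasurableSet B) (hBdd : Bornology.IsBounded B) (hC : MeasurableSet C)
    (hCvol : volume C ≠ ∞) {F : Set Ω} (hF : MeasurableSet[sigmaPoints Φe] F) (k : ℕ) :
    ∫⁻ ω in {ω | Disjoint (A.transmitters k ω) B} ∩ F,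
        ((A.receiverIndices k C ω).encard : ℝ≥0∞) ∂μ =
      lamL * ENNReal.ofReal (1 - p) * volume C *
        μ ({ω | Disjoint (A.transmitters k ω) B} ∩ F) := by
  have hrec := A.measurable_receiverIndices hΦe hC k
  have hmem (i : ℕ) : MeasurableSet {ω | i ∈ A.receiverIndices k C ω} :=
    hrec (measurableSet_mem i)
  have hcount {D : Set Plane} (hD : MeasurableSet D) (f : ℕ∞ → ℝ≥0∞) :
      Measurable[sigmaPoints Φl] fun ω => f (count Φl D ω) :=
    Measurable.of_discrete.comp (measurable_count_sigmaPoints hD)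
  have hterm (i : ℕ) : Measurable fun ω => (A.indices C ω).indicator
      (fun i => ENNReal.ofReal (1 - p) ^ (insert i (A.indices B ω)).ncard) i := by
    have hle := A.sigmaPositions_le hΦe
    have hinsert := (measurable_insert i).comp ((A.measurable_indices hB).mono hle le_rfl)
    exact ((measurable_const.pow measurable_ncard).comp hinsert).indicator
      (hle _ (A.measurable_indices hC (measurableSet_mem i)))
  rw [lintegral_encard _ hrec]
  simp_rw [Measure.restrict_apply (hmem _),
    A.measure_mem_receiverIndices_inter hp hΦl hΦe hB hBdd hC hF]
  rw [← lintegral_tsum fun i => (hterm i).aemeasurable,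
    A.measure_disjoint_transmitters_inter hp hΦl hΦe hindep hB hBdd hF,
    ← mul_assoc, ← hΦl.lintegral_count_inter_add_count_sdiff hB hBdd hC hCvol,
    ← setLIntegral_of_indep hΦl.sigmaPoints_le hΦe.sigmaPoints_le hindep _ hF]
  · refine lintegral_congr fun ω => ?_
    rw [tsum_indicator_pow_ncard_insert _ (A.finite_indices hΦl hBdd ω), indices_inter_indices,
      indices_sdiff_indices, encard_indices, encard_indices, ncard_indices]
  · exact ((hcount (hC.inter hB) _).mul (hcount hB fun n => _ ^ n.toNat)).add
      ((hcount (hC.diff hB) _).mul (hcount hB fun n => _ ^ (n.toNat + 1)))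

end Thinning

section Environment

variable {A} {k : ℕ}

/-- The void events of the transmitters in slot `k` over bounded Borel sets, intersected with the
events that depend on the eavesdroppers only. They form a π-system, and the σ-algebra they
generate determines to which points of the plane an added transmitter can securely connect. -/
def environmentEvents (A : SlottedAloha μ Φl Φe p) (k : ℕ) : Set (Set Ω) :=
  {E | ∃ B F, MeasurableSet B ∧ Bornology.IsBounded B ∧ MeasurableSet[sigmaPoints Φe] F ∧
    {ω | Disjoint (A.transmitters k ω) B} ∩ F = E}

theorem isPiSystem_environmentEvents : IsPiSystem (A.environmentEvents k) := by
  rintro _ ⟨B, F, hB, hBdd, hF, rfl⟩ _ ⟨B', F', hB', hBdd', hF', rfl⟩ -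
  refine ⟨B ∪ B', F ∩ F', hB.union hB', hBdd.union hBdd', hF.inter hF', ?_⟩
  simp_rw [Set.disjoint_union_right]
  exact Set.inter_inter_inter_comm _ _ _ _

theorem univ_mem_environmentEvents : Set.univ ∈ A.environmentEvents k :=
  ⟨∅, Set.univ, .empty, Bornology.isBounded_empty, .univ, by simp⟩

theorem generateFrom_environmentEvents_le {lamE : ℝ≥0} (hΦe : IsPoissonProcess μ Φe lamE) :
    MeasurableSpace.generateFrom (A.environmentEvents k) ≤ ‹MeasurableSpace Ω› := by
  refine MeasurableSpace.generateFrom_le ?_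
  rintro _ ⟨B, F, hB, -, hF, rfl⟩
  exact (A.measurableSet_disjoint_transmitters hB k).inter (hΦe.sigmaPoints_le _ hF)

theorem measurableSet_environment_disjoint_transmitters {B : Set Plane}
    (hBdd : Bornology.IsBounded B) (hB : MeasurableSet B) :
    MeasurableSet[.generateFrom (A.environmentEvents k)]
      {ω | Disjoint (A.transmitters k ω) B} :=
  MeasurableSpace.measurableSet_generateFrom
    ⟨B, Set.univ, hB, hBdd, .univ, Set.inter_univ _⟩

theorem sigmaPoints_le_generateFrom_environmentEvents :
    sigmaPoints Φe ≤ .generateFrom (A.environmentEvents k) := fun F hF =>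
  MeasurableSpace.measurableSet_generateFrom
    ⟨∅, F, .empty, Bornology.isBounded_empty, hF, by simp⟩

theorem measurableSet_environment_securelyConnects {lamL lamE : ℝ≥0}
    (hΦl : IsPoissonProcess μ Φl lamL) (hΦe : IsPoissonProcess μ Φe lamE) (η βl βe : ℝ)
    (x : Plane) :
    MeasurableSet[Prod.instMeasurableSpace (m₂ := .generateFrom (A.environmentEvents k))]
      {z : Plane × Ω |
        SecurelyConnects (insert x (A.transmitters k z.2)) (Φe z.2) η βl βe x z.1} :=
  measurableSet_securelyConnects (mΩ := .generateFrom (A.environmentEvents k))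
    (fun ω B hB => (hΦl.locallyFinite ω B hB).subset
      (Set.inter_subset_inter_left _ transmitters_subset))
    hΦe.locallyFinite (fun _ => measurableSet_environment_disjoint_transmitters)
    (fun _ _ hB => sigmaPoints_le_generateFrom_environmentEvents _
      (measurableSet_disjoint_sigmaPoints hB)) η βl βe x

end Environment

section OutDegree

variable {lamL lamE : ℝ≥0} {η βl βe : ℝ} {k : ℕ}

variable (η βl βe k) in
/-- The indices of the receivers to which a transmitter at the origin can securely connect. The
restriction to the disk of radius `η`, which the range constraint implies, makes the mean measure
of the receivers finite. -/
def outNeighborIndices (ω : Ω) : Set ℕ :=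
  {i ∈ A.receiverIndices k (Metric.ball 0 η) ω |
    SecurelyConnects (insert 0 (A.transmitters k ω)) (Φe ω) η βl βe 0 (A.node i ω)}

theorem encard_outNeighborIndices (ω : Ω) :
    (A.outNeighborIndices η βl βe k ω).encard = outDegreeAtOrigin A η βl βe k ω := by
  have hinj : Set.InjOn (A.node · ω) (A.outNeighborIndices η βl βe k ω) :=
    injOn_node_indices.mono fun i hi => hi.1.1
  rw [outDegreeAtOrigin, secureOutDegree, ← hinj.encard_image]
  congr 1
  ext y
  constructor
  · rintro ⟨i, ⟨hi, hconn⟩, rfl⟩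
    exact ⟨(image_receiverIndices.subset ⟨i, hi, rfl⟩).1, hconn⟩
  · rintro ⟨hy, hconn⟩
    have hball : y ∈ Metric.ball (0 : Plane) η := by simpa using hconn.range
    obtain ⟨i, hi, rfl⟩ := (image_receiverIndices (A := A)).superset ⟨hy, hball⟩
    exact ⟨i, ⟨hi, hconn⟩, rfl⟩

theorem measurable_outDegreeAtOrigin (hΦl : IsPoissonProcess μ Φl lamL)
    (hΦe : IsPoissonProcess μ Φe lamE) (η βl βe : ℝ) (k : ℕ) :
    Measurable (outDegreeAtOrigin A η βl βe k) := by
  have hrec : Measurable (A.receiverIndices k (Metric.ball 0 η)) :=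
    A.measurable_receiverIndices hΦe measurableSet_ball k
  rw [← funext (A.encard_outNeighborIndices (η := η) (βl := βl) (βe := βe) (k := k))]
  refine measurable_encard.comp (measurable_of_measurableSet_mem fun i => ?_)
  exact (hrec (measurableSet_mem i)).inter
    (((A.measurable_node i).prodMk
      (measurable_id'' (generateFrom_environmentEvents_le (A := A) (k := k) hΦe)))
      (measurableSet_environment_securelyConnects hΦl hΦe η βl βe 0))

variable [IsProbabilityMeasure μ]

theorem lintegral_outDegreeAtOrigin_eq_lintegral_measure (hp : 0 ≤ p)
    (hΦl : IsPoissonProcess μ Φl lamL) (hΦe : IsPoissonProcess μ Φe lamE)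
    (hindep : Indep (sigmaPoints Φl) (sigmaPoints Φe) μ) (η βl βe : ℝ) (k : ℕ) :
    ∫⁻ ω, (outDegreeAtOrigin A η βl βe k ω : ℝ≥0∞) ∂μ =
      lamL * ENNReal.ofReal (1 - p) * ∫⁻ y in Metric.ball 0 η,
        μ {ω | SecurelyConnects (insert 0 (A.transmitters k ω)) (Φe ω) η βl βe 0 y} := by
  have hle := A.generateFrom_environmentEvents_le (k := k) hΦe
  have hdensity : ∀ C, MeasurableSet C → ∀ D ∈ A.environmentEvents k,
      ∫⁻ ω in D,
          ({i ∈ A.receiverIndices k (Metric.ball 0 η) ω | A.node i ω ∈ C}.encard : ℝ≥0∞) ∂μ =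
        ((lamL * (1 - p).toNNReal) • volume.restrict (Metric.ball (0 : Plane) η)) C * μ D := by
    rintro C hC _ ⟨B, F, hB, hBdd, hF, rfl⟩
    have hset (ω : Ω) : {i ∈ A.receiverIndices k (Metric.ball 0 η) ω | A.node i ω ∈ C} =
        A.receiverIndices k (C ∩ Metric.ball 0 η) ω := by
      ext i
      simp only [receiverIndices, indices, Set.mem_ofPred_eq, Set.mem_inter_iff]
      tauto
    simp_rw [hset]
    rw [A.setLIntegral_encard_receiverIndices hp hΦl hΦe hindep hB hBdd
      (hC.inter measurableSet_ball)
      (measure_ne_top_of_subset Set.inter_subset_right measure_ball_lt_top.ne) hF k,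
      Measure.smul_apply, Measure.restrict_apply hC]
    rfl
  simp_rw [← encard_outNeighborIndices]
  refine (lintegral_encard_eq_lintegral_measure (Z := id)
    (mΘ := .generateFrom (A.environmentEvents k)) rfl isPiSystem_environmentEvents
    univ_mem_environmentEvents (A.measurable_receiverIndices hΦe measurableSet_ball k)
    A.measurable_node hle hdensity
    (measurableSet_environment_securelyConnects hΦl hΦe η βl βe 0)).trans ?_
  rw [lintegral_smul_measure]
  rfl

theorem measure_securelyConnects (hp0 : 0 ≤ p) (hp1 : p ≤ 1)
    (hΦl : IsPoissonProcess μ Φl lamL) (hΦe : IsPoissonProcess μ Φe lamE)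
    (hindep : Indep (sigmaPoints Φl) (sigmaPoints Φe) μ) (hβl : 0 ≤ βl) (hβe : 0 ≤ βe)
    {x y : Plane} (hxy : dist x y < η) (k : ℕ) :
    μ {ω | SecurelyConnects (insert x (A.transmitters k ω)) (Φe ω) η βl βe x y} =
      ENNReal.ofReal (Real.exp
        (-((lamL * p * βl ^ 2 + lamE * βe ^ 2) * Real.pi * dist x y ^ 2))) := by
  have hset : {ω | SecurelyConnects (insert x (A.transmitters k ω)) (Φe ω) η βl βe x y} =
      {ω | Disjoint (A.transmitters k ω) (Metric.closedBall y (βl * dist x y) \ {x})} ∩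
        {ω | Disjoint (Φe ω) (Metric.closedBall x (βe * dist x y))} := by
    ext ω
    simp only [securelyConnects_insert_self_iff, disjoint_sdiff_comm, hxy, true_and]
    rfl
  have hmeas : MeasurableSet (Metric.closedBall y (βl * dist x y) \ {x}) :=
    measurableSet_closedBall.diff (measurableSet_singleton x)
  have hBdd : Bornology.IsBounded (Metric.closedBall y (βl * dist x y) \ {x}) :=
    Metric.isBounded_closedBall.subset Set.sdiff_subset
  have harea : volume.real (Metric.closedBall y (βl * dist x y) \ {x}) =
      volume.real (Metric.closedBall y (βl * dist x y)) :=
    congrArg ENNReal.toReal (measure_sdiff_null (measure_singleton x))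
  rw [hset, A.measure_disjoint_transmitters_inter hp0 hΦl hΦe hindep hmeas hBdd
      (measurableSet_disjoint_sigmaPoints measurableSet_closedBall),
    hΦl.lintegral_pow_count hmeas hBdd.measure_lt_top.ne (sub_nonneg.2 hp1),
    hΦe.measure_disjoint measurableSet_closedBall measure_closedBall_lt_top.ne, harea,
    volume_real_closedBall _ (by positivity), volume_real_closedBall _ (by positivity),
    ← ENNReal.ofReal_mul (Real.exp_pos _).le, ← Real.exp_add]
  congr 2
  ring

theorem lintegral_outDegreeAtOrigin (hp0 : 0 ≤ p) (hp1 : p ≤ 1)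
    (hΦl : IsPoissonProcess μ Φl lamL) (hΦe : IsPoissonProcess μ Φe lamE)
    (hindep : Indep (sigmaPoints Φl) (sigmaPoints Φe) μ) (hβl : 0 ≤ βl) (hβe : 0 ≤ βe) (η : ℝ)
    (k : ℕ) :
    ∫⁻ ω, (outDegreeAtOrigin A η βl βe k ω : ℝ≥0∞) ∂μ =
      ENNReal.ofReal (lamL * (1 - p)) * ∫⁻ y in Metric.ball (0 : Plane) η, ENNReal.ofReal
        (Real.exp (-((lamL * p * βl ^ 2 + lamE * βe ^ 2) * Real.pi * ‖y‖ ^ 2))) := by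
  rw [A.lintegral_outDegreeAtOrigin_eq_lintegral_measure hp0 hΦl hΦe hindep,
    ENNReal.ofReal_mul (p := (lamL : ℝ)) lamL.2, ENNReal.ofReal_coe_nnreal]
  congr 1
  refine setLIntegral_congr_fun measurableSet_ball fun y hy => ?_
  rw [← dist_zero_left y]
  exact A.measure_securelyConnects hp0 hp1 hΦl hΦe hindep hβl hβe (Metric.mem_ball'.1 hy) k

end OutDegree

end SlottedAloha

end SecureGraph

open SecureGraph in
theorem mainTheorem1 {Ω : Type*} [MeasurableSpace Ω] (μ : Measure Ω) [IsProbabilityMeasure μ]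
    (Φl Φe : Ω → Set Plane) (lamL lamE : ℝ≥0) (p : ℝ) (hp0 : 0 ≤ p) (hp1 : p ≤ 1)
    (hΦl : IsPoissonProcess μ Φl lamL) (hΦe : IsPoissonProcess μ Φe lamE)
    (hindep : Indep (sigmaPoints Φl) (sigmaPoints Φe) μ)
    (A : SlottedAloha μ Φl Φe p)
    (η βl βe : ℝ) (hη : 0 < η) (hβl : 0 < βl) (hβe : 0 < βe)
    (hden : (lamL : ℝ) * p * βl ^ 2 + (lamE : ℝ) * βe ^ 2 ≠ 0) (k : ℕ) :
    Measurable (outDegreeAtOrigin A η βl βe k) ∧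
    ∫⁻ ω, (outDegreeAtOrigin A η βl βe k ω : ℝ≥0∞) ∂μ =
      ENNReal.ofReal
        ((lamL : ℝ) * (1 - p) *
            (1 - Real.exp (-((lamL * p * βl ^ 2 + lamE * βe ^ 2) * Real.pi * η ^ 2))) /
          (lamL * p * βl ^ 2 + lamE * βe ^ 2)) := by
  refine ⟨A.measurable_outDegreeAtOrigin hΦl hΦe η βl βe k, ?_⟩
  have hnonneg : 0 ≤ (lamL : ℝ) * (1 - p) := mul_nonneg lamL.2 (sub_nonneg.2 hp1)
  rw [A.lintegral_outDegreeAtOrigin hp0 hp1 hΦl hΦe hindep hβl.le hβe.le,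
    setLIntegral_ball_exp_neg_mul_norm_sq hden hη.le, ← ENNReal.ofReal_mul hnonneg, mul_div_assoc]
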